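/- Let $p\neq q$ be primes, let $n,m\ge 1$ be integers, and let $G=\mathrm{El}(p^n)\times\mathrm{El}(q^m)$, where $\mathrm{El}(p^n)$ denotes the elementary abelian group of order $p^n$ (every non-identity element has order $p$). The power graph $\mathcal P(G)$ has vertex set $G$, and two distinct elements are adjacent if and only if one of them is a positive power of the other. Let $D$ be its distance matrix and write $\phi(M,x)=\det(xI-M)$. Put $\alpha=\frac{p^n-1}{p-1}$ and $\beta=\frac{q^m-1}{q-1}$. Let $V_1=\{(e,e)\}$, $V_2=\{(a,e):a\ne e\}$, $V_3=\{(a,b):a\neq e,\ b\ne e\}$, $V_4=\{(e,b): b\neq e\}$. Then $\{V_1,V_2,V_3,V_4\}$ is an equitable partition of $\mathcal P(G)$ (the classes are non-empty and partition $G$, and for all $i,j$ every vertex of $V_i$ has the same number of neighbours in $V_j$), and its distance quotient matrix $T_1^D$, whose $(i,j)$ entry is the common value of $\sum_{v\in V_j}d(u,v)$ for $u\in V_i$, is $$T_1^D=\begin{pmatrix} 0& p^n-1 & (p^n-1)(q^m-1) & q^m-1\\ 1& 2p^n-p-2 & (2p^n-p-1)(q^m-1) & 2(q^m-1)\\ 1&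 2p^n-p-1 & 2(p^n-1)(q^m-1)-(p-1)(q-1)-1 & 2q^m-q-1\\ 1& 2(p^n-1) & (p^n-1)(2q^m-q-1) & 2q^m-q-2 \end{pmatrix}.$$ Moreover, the characteristic polynomial of the distance matrix $D$ of $\mathcal P(G)$ is $$\phi(D,x)=\phi(T_1^D,x)\,(x+1)^{p^nq^m-(\alpha+1)(\beta+1)}\,\bigl(x+(p-1)(q-1)+1\bigr)^{(\alpha-1)(\beta-1)}\,f(x)^{\alpha-1}\,g(x)^{\beta-1},$$ where $f(x)$ and $g(x)$ are the characteristic polynomials of $$\begin{pmatrix}-p&(1-p)(q^m-1)\\ 1-p&(1-p)(q-1)-1\end{pmatrix}\quad\text{and}\quad \begin{pmatrix}(p-1)(1-q)-1&1-q\\ (p^n-1)(1-q)&-q\end{pmatrix},$$ respectively. -/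

import Mathlib

open Polynomial

/-- The power graph of a group: distinct `a`, `b` are adjacent iff one of them is a
(positive) power of the other. -/
def powerGraph (G : Type*) [Group G] : SimpleGraph G where
  Adj a b := a ≠ b ∧ ((∃ k : ℕ, 0 < k ∧ b ^ k = a) ∨ (∃ k : ℕ, 0 < k ∧ a ^ k = b))
  symm := ⟨fun _ _ h => ⟨h.1.symm, h.2.symm⟩⟩
  loopless := ⟨fun _ h => h.1 rfl⟩

/-- The power graph of a finite group is connected, so that its graph distance
(which Mathlib sets to `0` between different components) is the genuine one. -/
theorem powerGraph_connected (G : Type*) [Group G] [Finite G] : (powerGraph G).Connected := by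
  have h : ∀ a : G, (powerGraph G).Reachable a 1 := by
    intro a
    by_cases ha : a = 1
    · rw [ha]
    · exact SimpleGraph.Adj.reachable
        ⟨ha, Or.inr ⟨orderOf a, orderOf_pos a, pow_orderOf_eq_one a⟩⟩
  exact { preconnected := fun a b => (h a).trans (h b).symm, nonempty := ⟨1⟩ }

/-- `G` is elementary abelian of order `p ^ n` (for a prime `p`), that is `G = El(p ^ n)`:
it is commutative, every non-identity element has order `p`, and `|G| = p ^ n`. -/
structure IsElementaryAbelian (G : Type*) [CommGroup G] (p n : ℕ) : Prop where
  orderOf_eq : ∀ a : G, a ≠ 1 → orderOf a = p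
  card_eq : Nat.card G = p ^ n

/-- The distance matrix of a graph, with real entries. -/
noncomputable def distMatrix {V : Type*} (Γ : SimpleGraph V) : Matrix V V ℝ :=
  Matrix.of fun u v => (Γ.dist u v : ℝ)

/-- The cells `c i` form an equitable partition of the vertex set of `Γ`: they are non-empty,
every vertex lies in exactly one of them, and the number of neighbours in `c j` is the same
for all vertices of `c i`. -/
structure IsEquitablePartition {V ι : Type*} (Γ : SimpleGraph V) (c : ι → Set V) : Prop where
  nonempty : ∀ i, (c i).Nonempty
  existsUnique : ∀ v, ∃! i, v ∈ c i
  equitable : ∀ i j, ∀ u ∈ c i, ∀ v ∈ c i,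
    (Γ.neighborSet u ∩ c j).ncard = (Γ.neighborSet v ∩ c j).ncard

open Classical in
/-- `T` is the distance quotient matrix of `Γ` with respect to the equitable partition `c`:
every row of the block of the distance matrix with rows in `c i` and columns in `c j`
has sum `T i j`. As the cells are non-empty, `T` is determined by `Γ` and `c`. -/
structure IsDistQuotientMatrix {V ι : Type*} [Fintype V] (Γ : SimpleGraph V) (c : ι → Set V)
    (T : Matrix ι ι ℝ) : Prop where
  isEquitablePartition : IsEquitablePartition Γ c
  rowSum_eq : ∀ i j, ∀ u ∈ c i, ∑ v with v ∈ c j, distMatrix Γ u v = T i j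

/-- The partition of `A × B` into `{(e, e)}`, `{(a, e) | a ≠ e}`, `{(a, b) | a ≠ e, b ≠ e}` and
`{(e, b) | b ≠ e}`, in this order. -/
def fourCells (A B : Type*) [Group A] [Group B] : Fin 4 → Set (A × B) :=
  ![{x | x.1 = 1 ∧ x.2 = 1}, {x | x.1 ≠ 1 ∧ x.2 = 1},
    {x | x.1 ≠ 1 ∧ x.2 ≠ 1}, {x | x.1 = 1 ∧ x.2 ≠ 1}]

/-- The number `(p ^ n - 1) / (p - 1)` of subgroups of order `p` of `El(p ^ n)`. For `p ≥ 2` both subtractions and the division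
are exact. -/
def numSubgroups (p n : ℕ) : ℕ := (p ^ n - 1) / (p - 1)

/-- The explicit distance quotient matrix of the power graph of `El(p ^ n) × El(q ^ m)` for the
partition `fourCells`. -/
def quotientMatrixD (p n q m : ℕ) : Matrix (Fin 4) (Fin 4) ℝ :=
  !![0, (p : ℝ) ^ n - 1, ((p : ℝ) ^ n - 1) * ((q : ℝ) ^ m - 1), (q : ℝ) ^ m - 1;
     1, 2 * (p : ℝ) ^ n - p - 2, (2 * (p : ℝ) ^ n - p - 1) * ((q : ℝ) ^ m - 1),
       2 * ((q : ℝ) ^ m - 1);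
     1, 2 * (p : ℝ) ^ n - p - 1,
       2 * ((p : ℝ) ^ n - 1) * ((q : ℝ) ^ m - 1) - ((p : ℝ) - 1) * ((q : ℝ) - 1) - 1,
       2 * (q : ℝ) ^ m - q - 1;
     1, 2 * ((p : ℝ) ^ n - 1), ((p : ℝ) ^ n - 1) * (2 * (q : ℝ) ^ m - q - 1),
       2 * (q : ℝ) ^ m - q - 2]

/-- The matrix whose characteristic polynomial is `f`. -/
def matrixB (p q m : ℕ) : Matrix (Fin 2) (Fin 2) ℝ :=
  !![-(p : ℝ), (1 - (p : ℝ)) * ((q : ℝ) ^ m - 1);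
     1 - (p : ℝ), (1 - (p : ℝ)) * ((q : ℝ) - 1) - 1]

/-- The matrix whose characteristic polynomial is `g`. -/
def matrixC (p n q : ℕ) : Matrix (Fin 2) (Fin 2) ℝ :=
  !![((p : ℝ) - 1) * (1 - (q : ℝ)) - 1, 1 - (q : ℝ);
     ((p : ℝ) ^ n - 1) * (1 - (q : ℝ)), -(q : ℝ)]

/-! The identity is adjacent to everything, so the diameter is at most two and `d(u, v) = 2 - [u, v
comparable] - [u = v]`, where comparable means that one is a power of the other. As `p` and `q` are
coprime, comparability can be read off coordinatewise, and in each factor it depends only on the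
cyclic subgroup generated by the element. So `D + 1` is pulled back from the set `Option K × Option
L` of pairs of classes, where `K` and `L` index the subgroups of order `p` and `q`, and `none` is
the class of the identity.

The characteristic polynomial then factors by repeated collapsing along a map of index sets.
Functions with zero sum over each fibre account for the factors split off, and functions constant on
fibres for the smaller matrix that remains. The engine is `charpoly_add_mul_of_intertwine`, which
replaces eigenvectors by a block conjugation. Collapsing elements to classes yields the power of `X
+ 1` (`charpoly_comap_sub_one`). Merging the classes `some k` of the first factor, then those of the
second, by `charpoly_option_prod`, yields `f`, `g` and the linear factor. What remains, on `Bool ×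
Bool`, is the quotient matrix. -/

namespace Matrix

/-! ### Characteristic polynomials under collapsing of the index set -/

section CommRing

variable {R : Type*} [CommRing R]

/-- If `P` intertwines `S` and `S₀`, the perturbations `S + P * M` and `S₀ + M * P` have
characteristic polynomials in the same ratio as those of `S` and `S₀`. -/
theorem charpoly_add_mul_of_intertwine {V W : Type*} [Fintype V] [DecidableEq V] [Fintype W]
    [DecidableEq W] (S : Matrix V V R) (S₀ : Matrix W W R) (P : Matrix V W R) (M : Matrix W V R)
    (h : S * P = P * S₀) :
    (S + P * M).charpoly * S₀.charpoly = S.charpoly * (S₀ + M * P).charpoly := by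
  -- Each side is the characteristic polynomial of a block triangular matrix. Conjugation by the
  -- unipotent matrix with upper right block `P` carries one to the other; the upper right block
  -- vanishes exactly because `S * P = P * S₀`.
  rw [← charpoly_fromBlocks_zero₁₂ (S + P * M) M S₀, ← charpoly_fromBlocks_zero₁₂ S M (S₀ + M * P)]
  have h₁ : fromBlocks (1 : Matrix V V R) (-P) 0 (1 : Matrix W W R) * fromBlocks 1 P 0 1 = 1 := by
    simp [fromBlocks_multiply]
  have h₂ : fromBlocks (S + P * M) 0 M S₀ =
      fromBlocks 1 P 0 1 * fromBlocks S 0 M (S₀ + M * P) * fromBlocks 1 (-P) 0 1 := by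
    simp only [fromBlocks_multiply, Matrix.one_mul, Matrix.mul_one, Matrix.zero_mul,
      Matrix.mul_zero, zero_add, add_zero]
    congr 1
    · rw [Matrix.add_mul, Matrix.mul_add, Matrix.mul_neg, Matrix.mul_neg, h, Matrix.mul_assoc]
      abel
    · rw [Matrix.mul_neg]
      abel
  rw [h₂, charpoly_mul_comm, ← Matrix.mul_assoc, h₁, Matrix.one_mul]

/-- The intertwiner is the 0/1 incidence matrix of `π`: constancy of the fibre row sums of `S` is
the relation `S * P = P * S₀`, and a perturbation whose rows depend only on `π` factors through `P`.
-/
theorem charpoly_add_of_fiber {V W : Type*} [Fintype V] [DecidableEq V] [Fintype W]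
    [DecidableEq W] (π : V → W) (S : Matrix V V R) (S₀ : Matrix W W R) (F : Matrix W V R)
    (h : ∀ x j, ∑ x' with π x' = j, S x x' = S₀ (π x) j) :
    (S + of fun x x' => F (π x) x').charpoly * S₀.charpoly =
      S.charpoly * (S₀ + of fun i j => ∑ x with π x = j, F i x).charpoly := by
  let P : Matrix V W R := of fun x i => if π x = i then 1 else 0
  have hP : S * P = P * S₀ := by
    ext x j
    simp [P, mul_apply, ← h, Finset.sum_filter]
  have h₁ : P * F = of fun x x' => F (π x) x' := by
    ext x x'
    simp [P, mul_apply]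
  have h₂ : F * P = of fun i j => ∑ x with π x = j, F i x := by
    ext i j
    simp [P, mul_apply, Finset.sum_filter]
  rw [← h₁, ← h₂, charpoly_add_mul_of_intertwine S S₀ P F hP]

theorem charpoly_neg_one {V : Type*} [Fintype V] [DecidableEq V] :
    (-1 : Matrix V V R).charpoly = (X + 1) ^ Fintype.card V := by
  have : (-1 : Matrix V V R) = diagonal fun _ => -1 := by
    rw [← diagonal_one, diagonal_neg]
  simp [this, charpoly_diagonal]

open scoped Kronecker in
theorem charpoly_one_kronecker {V W : Type*} [Fintype V] [DecidableEq V] [Fintype W]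
    [DecidableEq W] (S : Matrix W W R) :
    ((1 : Matrix V V R) ⊗ₖ S).charpoly = S.charpoly ^ Fintype.card V := by
  have : ((1 : Matrix V V R) ⊗ₖ S).charmatrix = (1 : Matrix V V R[X]) ⊗ₖ S.charmatrix := by
    ext1 ⟨x, i⟩ ⟨y, j⟩
    by_cases hxy : x = y <;> by_cases hij : i = j <;>
      simp [hxy, hij]
  rw [charpoly, this, det_kronecker, det_one, one_pow, one_mul, charpoly]

/-- A matrix that, up to `-1`, depends only on the images of its indices under `π`. -/
theorem charpoly_comap_sub_one {V W : Type*} [Fintype V] [DecidableEq V] [Fintype W]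
    [DecidableEq W] (π : V → W) (F : Matrix W W R) :
    (F.submatrix π π - 1).charpoly * (X + 1) ^ Fintype.card W =
      (X + 1) ^ Fintype.card V *
        ((of fun i j => ∑ x with π x = j, F i j) - 1).charpoly := by
  have := charpoly_add_of_fiber π (-1 : Matrix V V R) (-1) (of fun i x => F i (π x)) (by
    intro x j
    simp [one_apply, Finset.sum_neg_distrib])
  rw [charpoly_neg_one, charpoly_neg_one] at this
  convert this using 3
  · rw [neg_add_eq_sub]; rfl
  · rw [neg_add_eq_sub]
    congr 1
    ext i j
    simp only [of_apply]
    exact Finset.sum_congr rfl fun x hx => by rw [(Finset.mem_filter.1 hx).2]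

end CommRing

open scoped Kronecker in
/-- A matrix on `Option K × ι` whose blocks off `S` depend only on whether the `K`-coordinates
are `none`. -/
theorem charpoly_option_prod {R : Type*} [CommRing R] [IsDomain R] {K ι : Type*} [Fintype K]
    [DecidableEq K] [Nonempty K] [Fintype ι] [DecidableEq ι] (S : Matrix ι ι R)
    (F : Bool → Bool → Matrix ι ι R) :
    ((1 : Matrix (Option K) (Option K) R) ⊗ₖ S +
        of fun u v : Option K × ι => F u.1.isSome v.1.isSome u.2 v.2).charpoly =
      S.charpoly ^ (Fintype.card K - 1) *
        ((1 : Matrix Bool Bool R) ⊗ₖ S + of fun u v : Bool × ι =>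
          (bif v.1 then (Fintype.card K : R) else 1) * F u.1 v.1 u.2 v.2).charpoly := by
  have key := charpoly_add_of_fiber (fun x : Option K × ι => (x.1.isSome, x.2))
    ((1 : Matrix (Option K) (Option K) R) ⊗ₖ S) ((1 : Matrix Bool Bool R) ⊗ₖ S)
    (of fun i x => F i.1 x.1.isSome i.2 x.2) (by
      rintro ⟨x, i⟩ ⟨b, j⟩
      rw [Finset.sum_filter, Fintype.sum_prod_type]
      cases x <;> cases b <;>
        simp [Fintype.sum_option, one_apply, Prod.ext_iff, ite_and])
  rw [charpoly_one_kronecker, charpoly_one_kronecker, Fintype.card_bool] at key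
  obtain ⟨c, hc⟩ : ∃ c, Fintype.card K = c + 1 :=
    Nat.exists_eq_succ_of_ne_zero Fintype.card_ne_zero
  have hcard : Fintype.card (Option K) = c + 2 := by rw [Fintype.card_option, hc]
  -- The unperturbed matrices contribute `|K| + 1` and `2` copies of the characteristic polynomial
  -- of `S`; cancelling two leaves `|K| - 1`.
  refine mul_right_cancel₀ (pow_ne_zero 2 S.charpoly_monic.ne_zero) (key.trans ?_)
  rw [hcard, pow_add, mul_assoc, mul_right_comm, hc, Nat.add_sub_cancel, mul_assoc]
  congr 4
  ext ⟨a, i⟩ ⟨b, j⟩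
  rw [of_apply, of_apply, Finset.sum_filter, Fintype.sum_prod_type]
  cases b <;> simp [Fintype.sum_option, Prod.ext_iff, ite_and, hc]

end Matrix

/-! ### Classes of elements generating the same cyclic subgroup -/

/-- Comparability, in both orders, of pairs of classes, where `none` lies below everything and
the other classes are pairwise incomparable. -/
def ClassComparable {K L : Type*} (u v : Option K × Option L) : Prop :=
  ((u.1 = none ∨ u.1 = v.1) ∧ (u.2 = none ∨ u.2 = v.2)) ∨
    ((v.1 = none ∨ v.1 = u.1) ∧ (v.2 = none ∨ v.2 = u.2))

instance {K L : Type*} [DecidableEq K] [DecidableEq L] (u v : Option K × Option L) :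
    Decidable (ClassComparable u v) := by
  unfold ClassComparable; infer_instance

/-- `π` sends `1` to `none` and two other elements to the same `some k` iff they generate the same
subgroup; every class `some k` has `p - 1` elements. -/
structure IsCyclicClassMap {A K : Type*} [Group A] (p : ℕ) (π : A → Option K) : Prop where
  eq_none_iff : ∀ a, π a = none ↔ a = 1
  ncard_fiber : ∀ k, {a | π a = some k}.ncard = p - 1
  exists_pow_iff : ∀ a b, (∃ j : ℕ, b ^ j = a) ↔ (π a = none ∨ π a = π b)

theorem IsCyclicClassMap.sum_comp {A K : Type*} [Group A] [Fintype A] [Fintype K] {p : ℕ}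
    (hp : 1 ≤ p) {π : A → Option K} (h : IsCyclicClassMap p π) (G : Option K → ℝ) :
    ∑ a, G (π a) = G none + ((p : ℝ) - 1) * ∑ k, G (some k) := by
  classical
  have hnone : ({a | π a = none} : Finset A) = {1} := by
    ext a; simp [h.eq_none_iff]
  have hsome : ∀ k, ({a | π a = some k} : Finset A).card = p - 1 := fun k => by
    rw [← h.ncard_fiber k, Set.ncard_eq_toFinset_card', Set.toFinset_ofPred]
  have key : ∀ y, ∑ a with π a = y, G (π a) = (({a | π a = y} : Finset A).card : ℝ) * G y := by
    intro y
    rw [← nsmul_eq_mul, ← Finset.sum_const]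
    exact Finset.sum_congr rfl fun a ha => by rw [(Finset.mem_filter.1 ha).2]
  rw [← Finset.sum_fiberwise Finset.univ π, Finset.sum_congr rfl fun y _ => key y,
    Fintype.sum_option, Finset.mul_sum]
  simp only [hnone, hsome, Finset.card_singleton, Nat.cast_one, one_mul, Nat.cast_sub hp]

theorem IsCyclicClassMap.card_eq {A K : Type*} [Group A] [Fintype A] [Fintype K] {p : ℕ}
    (hp : 1 ≤ p) {π : A → Option K} (h : IsCyclicClassMap p π) :
    (Fintype.card A : ℝ) = 1 + ((p : ℝ) - 1) * Fintype.card K := by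
  simpa using h.sum_comp hp fun _ => 1

theorem numSubgroups_mul_add_one {p : ℕ} (hp : 1 ≤ p) (n : ℕ) :
    numSubgroups p n * (p - 1) + 1 = p ^ n := by
  have h : p - 1 ∣ p ^ n - 1 := by simpa using Nat.sub_dvd_pow_sub_pow p 1 n
  rw [numSubgroups, Nat.div_mul_cancel h, Nat.sub_add_cancel (Nat.one_le_pow _ _ hp)]

theorem numSubgroups_add_one_le {p : ℕ} (hp : 2 ≤ p) (n : ℕ) : numSubgroups p n + 1 ≤ p ^ n := by
  rw [← numSubgroups_mul_add_one (by omega) n]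
  exact Nat.succ_le_succ (Nat.le_mul_of_pos_right _ (by omega))

theorem IsCyclicClassMap.card_eq_numSubgroups {A K : Type*} [Group A] [Fintype A] [Fintype K]
    {p n : ℕ} (hp : 2 ≤ p) (hn : 1 ≤ n) {π : A → Option K} (h : IsCyclicClassMap p π)
    (hA : Fintype.card A = p ^ n) :
    (p : ℝ) ^ n = 1 + ((p : ℝ) - 1) * Fintype.card K ∧ Fintype.card K = numSubgroups p n ∧
      Nonempty K := by
  have h₁ := h.card_eq (by omega)
  rw [hA, Nat.cast_pow] at h₁
  have h₂ : (Fintype.card K : ℝ) = numSubgroups p n := by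
    have h₃ : ((numSubgroups p n * (p - 1) + 1 : ℕ) : ℝ) = (p : ℝ) ^ n := by
      rw [numSubgroups_mul_add_one (by omega), Nat.cast_pow]
    push_cast [Nat.cast_sub (by omega : 1 ≤ p)] at h₃
    have h₄ : (2 : ℝ) ≤ p := by exact_mod_cast hp
    refine mul_left_cancel₀ (by linarith : (p : ℝ) - 1 ≠ 0) ?_
    linarith
  have h₅ : Fintype.card K = numSubgroups p n := by exact_mod_cast h₂
  refine ⟨h₁, h₅, Fintype.card_pos_iff.1 ?_⟩
  have h₆ := numSubgroups_mul_add_one (by omega : 1 ≤ p) n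
  have h₇ : 1 < p ^ n := Nat.one_lt_pow (by omega) (by omega)
  rw [h₅]
  refine Nat.pos_of_ne_zero fun h₀ => ?_
  rw [h₀] at h₆
  omega

/-- All non-trivial cyclic subgroups have the same order `p`, so a non-identity element of one
generates it. Hence each has `p - 1` generators, and being a power of a non-identity element means
being trivial or generating the same subgroup. -/
theorem IsElementaryAbelian.exists_isCyclicClassMap {A : Type*} [CommGroup A] [Fintype A]
    {p n : ℕ} (hA : IsElementaryAbelian A p n) :
    ∃ π : A → Option {H : Subgroup A // ∃ a, a ≠ 1 ∧ Subgroup.zpowers a = H},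
      IsCyclicClassMap p π := by
  classical
  have zp : ∀ a b : A, b ≠ 1 → b ∈ Subgroup.zpowers a →
      Subgroup.zpowers b = Subgroup.zpowers a := by
    intro a b hb hba
    have ha : a ≠ 1 := by
      rintro rfl
      exact hb (by simpa using hba)
    refine Subgroup.eq_of_le_of_card_ge (by simpa using hba) ?_
    rw [Nat.card_zpowers, Nat.card_zpowers, hA.orderOf_eq a ha, hA.orderOf_eq b hb]
  have pw : ∀ a b : A, (∃ j : ℕ, b ^ j = a) ↔ a ∈ Subgroup.zpowers b := by
    intro a b
    rw [← mem_powers_iff_mem_zpowers, Submonoid.mem_powers_iff]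
  refine ⟨fun a => if h : a = 1 then none else some ⟨Subgroup.zpowers a, a, h, rfl⟩, ?_, ?_, ?_⟩
  · intro a
    by_cases h : a = 1 <;> simp [h]
  · rintro ⟨H, a, ha, rfl⟩
    have : {b : A | (if h : b = 1 then none else some (⟨Subgroup.zpowers b, b, h, rfl⟩ :
        {H : Subgroup A // ∃ a, a ≠ 1 ∧ Subgroup.zpowers a = H})) =
          some ⟨Subgroup.zpowers a, a, ha, rfl⟩} = (Subgroup.zpowers a : Set A) \ {1} := by
      ext b
      by_cases h : b = 1
      · simp [h]
      · simp only [Set.mem_ofPred_eq, h, dite_false, Option.some.injEq, Subtype.mk.injEq,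
          Set.mem_sdiff, SetLike.mem_coe, Set.mem_singleton_iff, not_false_eq_true, and_true]
        exact ⟨fun e => e ▸ Subgroup.mem_zpowers b, zp a b h⟩
    rw [this, Set.ncard_sdiff_singleton_of_mem (one_mem (Subgroup.zpowers a)),
      ← hA.orderOf_eq a ha, ← Nat.card_zpowers]
    rfl
  · intro a b
    rw [pw]
    by_cases h : a = 1
    · simp [h, one_mem]
    by_cases h' : b = 1
    · simp [h, h']
    · simp only [h, h', dite_false, Option.some.injEq, Subtype.mk.injEq, reduceCtorEq, false_or]
      exact ⟨zp b a h, fun e => e ▸ Subgroup.mem_zpowers a⟩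

/-! ### Powers in the product and distances -/

theorem IsElementaryAbelian.pow_eq_one {A : Type*} [CommGroup A] {p n : ℕ}
    (hA : IsElementaryAbelian A p n) (a : A) : a ^ p = 1 := by
  by_cases h : a = 1
  · simp [h]
  · rw [← hA.orderOf_eq a h, pow_orderOf_eq_one]

theorem exists_pos_pow_prod_iff {A B : Type*} [Group A] [Group B] {p q : ℕ} (hp : 0 < p)
    (hq : 0 < q) (hpq : p.Coprime q) (hA : ∀ a : A, a ^ p = 1) (hB : ∀ b : B, b ^ q = 1)
    (u v : A × B) :
    (∃ k : ℕ, 0 < k ∧ v ^ k = u) ↔ (∃ i : ℕ, v.1 ^ i = u.1) ∧ ∃ j : ℕ, v.2 ^ j = u.2 := by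
  constructor
  · rintro ⟨k, -, rfl⟩
    exact ⟨⟨k, rfl⟩, k, rfl⟩
  · rintro ⟨⟨i, hi⟩, j, hj⟩
    -- One exponent serves both coordinates by the Chinese remainder theorem; adding `p * q` makes
    -- it positive without changing the powers.
    obtain ⟨k, hki, hkj⟩ := Nat.chineseRemainder hpq i j
    refine ⟨k + p * q, by positivity, Prod.ext ?_ ?_⟩
    · rw [Prod.pow_fst, pow_add, pow_mul, hA, one_pow, mul_one, ← hi]
      exact pow_eq_pow_of_modEq hki (hA _)
    · rw [Prod.pow_snd, pow_add, mul_comm p, pow_mul, hB, one_pow, mul_one, ← hj]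
      exact pow_eq_pow_of_modEq hkj (hB _)

/-- Two non-adjacent vertices are joined by a path of length two through `1`. On the diagonal both
indicators equal one, which gives distance zero. -/
theorem distMatrix_powerGraph_eq {G : Type*} [Group G] [Finite G] [DecidableEq G] (u v : G)
    (c : Prop) [Decidable c]
    (hc : ((∃ k : ℕ, 0 < k ∧ v ^ k = u) ∨ (∃ k : ℕ, 0 < k ∧ u ^ k = v)) ↔ c) :
    distMatrix (powerGraph G) u v = 2 - (if c then 1 else 0) - (if u = v then 1 else 0) := by
  have hadj : ∀ a : G, a ≠ 1 → (powerGraph G).Adj a 1 := fun a ha =>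
    ⟨ha, Or.inr ⟨orderOf a, orderOf_pos a, pow_orderOf_eq_one a⟩⟩
  rw [distMatrix, Matrix.of_apply]
  by_cases huv : u = v
  · subst huv
    have : c := hc.1 (Or.inl ⟨1, one_pos, pow_one u⟩)
    simp [this]
    norm_num
  by_cases h : c
  · have : (powerGraph G).dist u v = 1 := SimpleGraph.dist_eq_one_iff_adj.2 ⟨huv, hc.2 h⟩
    simp [this, h, huv]
    norm_num
  · have hn : ¬ (powerGraph G).Adj u v := fun h' => h (hc.1 h'.2)
    have hu : u ≠ 1 := by
      rintro rfl
      exact hn (hadj v (Ne.symm huv)).symm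
    have hv : v ≠ 1 := by
      rintro rfl
      exact hn (hadj u hu)
    have hle : (powerGraph G).dist u v ≤ 2 :=
      SimpleGraph.dist_le ((SimpleGraph.Walk.nil.cons (hadj v hv).symm).cons (hadj u hu))
    have h0 : (powerGraph G).dist u v ≠ 0 := fun h0 =>
      huv (((powerGraph_connected G).dist_eq_zero_iff).1 h0)
    have h1 : (powerGraph G).dist u v ≠ 1 := fun h1 => hn (SimpleGraph.dist_eq_one_iff_adj.1 h1)
    have : (powerGraph G).dist u v = 2 := by omega
    simp [this, h, huv]

/-- The size of a class of `IsCyclicClassMap`. -/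
def classSize {K : Type*} (p : ℝ) (x : Option K) : ℝ := x.elim 1 fun _ => p - 1

@[simp] theorem classSize_none {K : Type*} (p : ℝ) : classSize p (none : Option K) = 1 := rfl

@[simp] theorem classSize_some {K : Type*} (p : ℝ) (k : K) : classSize p (some k) = p - 1 := rfl

/-! ### Collapsing the class matrix, one factor at a time -/

section Collapse

open scoped Kronecker

variable {K L : Type*} [DecidableEq K] [DecidableEq L]

/-- The quotient of the distance matrix with respect to the classes. -/
def classMatrix (K L : Type*) [DecidableEq K] [DecidableEq L] (p q : ℝ) :
    Matrix (Option K × Option L) (Option K × Option L) ℝ :=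
  Matrix.of fun u v => (2 - if ClassComparable u v then 1 else 0) *
    (classSize p v.1 * classSize q v.2) - if u = v then 1 else 0

/-- The action of `classMatrix` on functions that sum to zero over the classes of the first
factor. -/
def leftMatrix (L : Type*) [DecidableEq L] (p q : ℝ) : Matrix (Option L) (Option L) ℝ :=
  Matrix.of fun x y => -(p - 1) * classSize q y * (if x = none ∨ y = none ∨ x = y then 1 else 0) -
    if x = y then 1 else 0

/-- The part of `classMatrix` that sees only whether the first coordinates are `none`. -/
def leftRest (L : Type*) [DecidableEq L] (p q : ℝ) :
    Bool → Bool → Matrix (Option L) (Option L) ℝ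
  | true, true => Matrix.of fun _ y => 2 * (p - 1) * classSize q y
  | true, false => Matrix.of fun x y => (2 - if y = none ∨ y = x then 1 else 0) * classSize q y
  | false, true =>
    Matrix.of fun x y => (2 - if x = none ∨ x = y then 1 else 0) * ((p - 1) * classSize q y)
  | false, false => Matrix.of fun x y =>
      (2 + (p - 2) * if x = none ∨ y = none ∨ x = y then 1 else 0) * classSize q y

/-- `leftMatrix` is the difference between a diagonal and an off-diagonal block among the classes
`some k`. The Kronecker term also places it in the `none` block, and the coefficient `p - 2` in
`leftRest` compensates for that. -/
theorem classMatrix_eq (p q : ℝ) :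
    classMatrix K L p q = (1 : Matrix (Option K) (Option K) ℝ) ⊗ₖ leftMatrix L p q +
      Matrix.of fun u v => leftRest L p q u.1.isSome v.1.isSome u.2 v.2 := by
  ext ⟨x, i⟩ ⟨y, j⟩
  rcases x with _ | x <;> rcases y with _ | y <;> rcases i with _ | i <;> rcases j with _ | j <;>
    simp [classMatrix, leftMatrix, leftRest, ClassComparable, Matrix.one_apply, Prod.ext_iff,
      eq_comm]
  all_goals try by_cases hij : i = j
  all_goals try by_cases hxy : x = y
  all_goals try simp_all [eq_comm]
  all_goals try ring

/-- `leftMatrix` on functions that sum to zero over the classes. -/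
def leftCorner (p q : ℝ) : Matrix Unit Unit ℝ := Matrix.of fun _ _ => -((p - 1) * (q - 1) + 1)

/-- The rest of `leftMatrix`. -/
def leftCornerRest (p q : ℝ) : Bool → Bool → Matrix Unit Unit ℝ
  | true, true => 0
  | true, false => Matrix.of fun _ _ => -(p - 1)
  | false, true => Matrix.of fun _ _ => -(p - 1) * (q - 1)
  | false, false => Matrix.of fun _ _ => -p + ((p - 1) * (q - 1) + 1)

/-- The dummy factor `Unit` gives the index set the product shape that `charpoly_option_prod`
expects, with blocks of size one. -/
theorem leftMatrix_eq (p q : ℝ) :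
    (leftMatrix L p q).reindex (Equiv.prodPUnit _).symm (Equiv.prodPUnit _).symm =
      (1 : Matrix (Option L) (Option L) ℝ) ⊗ₖ leftCorner p q +
      Matrix.of fun u v => leftCornerRest p q u.1.isSome v.1.isSome u.2 v.2 := by
  ext ⟨x, i⟩ ⟨y, j⟩
  rcases x with _ | x <;> rcases y with _ | y <;>
    simp [leftMatrix, leftCorner, leftCornerRest, Matrix.one_apply]
  · ring
  · by_cases hxy : x = y <;> simp [hxy]
    ring

theorem charpoly_leftCorner (p q : ℝ) :
    (leftCorner p q).charpoly = X + C ((p - 1) * (q - 1) + 1) := by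
  simp [Matrix.charpoly, leftCorner, Matrix.det_unique]
  ring

theorem charpoly_leftMatrix [Fintype L] [Nonempty L] {q m : ℕ} (p : ℕ)
    (hL : (q : ℝ) ^ m = 1 + ((q : ℝ) - 1) * Fintype.card L) :
    (leftMatrix L p q).charpoly =
      (X + C (((p : ℝ) - 1) * ((q : ℝ) - 1) + 1)) ^ (Fintype.card L - 1) *
        (matrixB p q m).charpoly := by
  rw [← Matrix.charpoly_reindex (Equiv.prodPUnit _).symm, leftMatrix_eq,
    Matrix.charpoly_option_prod, charpoly_leftCorner,
    ← Matrix.charpoly_reindex (finTwoEquiv.trans (Equiv.prodPUnit _).symm) (matrixB p q m)]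
  congr 2
  ext ⟨x, i⟩ ⟨y, j⟩
  cases x <;> cases y <;>
    simp [leftCorner, leftCornerRest, matrixB, finTwoEquiv, hL] <;> ring

/-- `charpoly_option_prod` applied to `classMatrix` leaves this matrix, here with the factors
swapped. -/
def rightMatrix (L : Type*) [DecidableEq L] (p q α : ℝ) :
    Matrix (Option L × Bool) (Option L × Bool) ℝ :=
  Matrix.of fun u v => (if u.2 = v.2 then leftMatrix L p q u.1 v.1 else 0) +
    (bif v.2 then α else 1) * leftRest L p q u.2 v.2 u.1 v.1

/-- The action of `rightMatrix` on functions that sum to zero over the classes. -/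
def rightCorner (p q α : ℝ) : Matrix Bool Bool ℝ
  | true, true => -(p - 1) * (q - 1) - 1
  | true, false => -(q - 1)
  | false, true => -(p - 1) * (q - 1) * α
  | false, false => -q

/-- The rest of `rightMatrix`. -/
def rightRest (p q α : ℝ) : Bool → Bool → Matrix Bool Bool ℝ
  | true, true => Matrix.of fun _ c => 2 * (bif c then α * (p - 1) else 1) * (q - 1)
  | false, true => fun
    | true, true => -(p - 1) * (q - 1) + 2 * α * (p - 1) * (q - 1)
    | true, false => 2 * (q - 1)
    | false, true => α * (p - 1) * (q - 1)
    | false, false => q - 1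
  | true, false => fun
    | true, true => -(p - 1) + 2 * α * (p - 1)
    | true, false => 1
    | false, true => 2 * α * (p - 1)
    | false, false => 1
  | false, false => Matrix.of (fun
    | true, true => -p + 2 * α * (p - 1)
    | true, false => 1
    | false, true => α * (p - 1)
    | false, false => 0) - rightCorner p q α

theorem rightMatrix_eq (p q α : ℝ) :
    rightMatrix L p q α = (1 : Matrix (Option L) (Option L) ℝ) ⊗ₖ rightCorner p q α +
      Matrix.of fun u v => rightRest p q α u.1.isSome v.1.isSome u.2 v.2 := by
  ext ⟨x, i⟩ ⟨y, j⟩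
  rcases x with _ | x <;> rcases y with _ | y <;> cases i <;> cases j <;>
    simp [rightMatrix, leftMatrix, leftRest, rightCorner, rightRest, Matrix.one_apply]
  all_goals try by_cases hxy : x = y
  all_goals try simp [hxy, eq_comm]
  all_goals first | ring1 | exact Or.inl (by ring1)

/-- The cells of `fourCells` correspond to the pairs of booleans that tell whether the coordinates
differ from `1`. -/
def cellEquiv : Fin 4 ≃ Bool × Bool where
  toFun := ![(false, false), (true, false), (true, true), (false, true)]
  invFun x := bif x.1 then (bif x.2 then 2 else 1) else (bif x.2 then 3 else 0)
  left_inv := by decide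
  right_inv := by decide

/-- The class sizes times the numbers of classes give `p ^ n - 1` and `q ^ m - 1`, so the fully
collapsed matrix is the quotient matrix in the order of `cellEquiv`. The negation on `Bool` appears
because `matrixC` lists the non-identity part of the first factor first. -/
theorem charpoly_rightMatrix [Fintype L] [Nonempty L] {p n q m : ℕ} {α : ℝ}
    (hK : (p : ℝ) ^ n = 1 + ((p : ℝ) - 1) * α)
    (hL : (q : ℝ) ^ m = 1 + ((q : ℝ) - 1) * Fintype.card L) :
    (rightMatrix L p q α).charpoly =
      (matrixC p n q).charpoly ^ (Fintype.card L - 1) * (quotientMatrixD p n q m).charpoly := by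
  rw [rightMatrix_eq, Matrix.charpoly_option_prod,
    ← Matrix.charpoly_reindex (finTwoEquiv.trans Equiv.boolNot) (matrixC p n q),
    ← Matrix.charpoly_reindex (cellEquiv.trans (Equiv.prodComm _ _)) (quotientMatrixD p n q m)]
  congr 3
  · ext x y
    cases x <;> cases y <;>
      simp [rightCorner, matrixC, finTwoEquiv, Equiv.boolNot, hK] <;> ring
  · ext ⟨x, i⟩ ⟨y, j⟩
    cases x <;> cases y <;> cases i <;> cases j <;>
      simp [rightCorner, rightRest, quotientMatrixD, cellEquiv, hK, hL] <;> ring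

/-- Collapsing the first factor splits off `|K| - 1` copies of the polynomial of `leftMatrix`,
itself `f` times `|L| - 1` linear factors; this is the source of the product exponent. -/
theorem charpoly_classMatrix [Fintype K] [Fintype L] [Nonempty K] [Nonempty L] {p n q m : ℕ}
    (hK : (p : ℝ) ^ n = 1 + ((p : ℝ) - 1) * Fintype.card K)
    (hL : (q : ℝ) ^ m = 1 + ((q : ℝ) - 1) * Fintype.card L) :
    (classMatrix K L p q).charpoly = (quotientMatrixD p n q m).charpoly *
        (X + C (((p : ℝ) - 1) * ((q : ℝ) - 1) + 1)) ^
          ((Fintype.card K - 1) * (Fintype.card L - 1)) *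
        (matrixB p q m).charpoly ^ (Fintype.card K - 1) *
        (matrixC p n q).charpoly ^ (Fintype.card L - 1) := by
  rw [classMatrix_eq, Matrix.charpoly_option_prod, charpoly_leftMatrix p hL,
    ← Matrix.charpoly_reindex (Equiv.prodComm Bool (Option L))]
  have h : Matrix.reindex (Equiv.prodComm Bool (Option L)) (Equiv.prodComm Bool (Option L))
      ((1 : Matrix Bool Bool ℝ) ⊗ₖ leftMatrix L p q +
        Matrix.of fun u v : Bool × Option L => (bif v.1 then (Fintype.card K : ℝ) else 1) *
          leftRest L p q u.1 v.1 u.2 v.2) = rightMatrix L p q (Fintype.card K) := by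
    ext ⟨x, i⟩ ⟨y, j⟩
    simp [rightMatrix, Matrix.one_apply]
  rw [h, charpoly_rightMatrix hK hL, mul_pow, ← pow_mul]
  ring

end Collapse

/-! ### Table of comparabilities between classes -/

section ClassComparable

variable {K L : Type*}

@[simp] theorem classComparable_bot_left (v : Option K × Option L) :
    ClassComparable ((none, none) : Option K × Option L) v ↔ True := by
  simp [ClassComparable]

@[simp] theorem classComparable_bot_right (u : Option K × Option L) :
    ClassComparable u (none, none) ↔ True := by
  simp [ClassComparable]

@[simp] theorem classComparable_none_some_none_some (y b : L) :
    ClassComparable ((none, some y) : Option K × Option L) (none, some b) ↔ y = b := by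
  simp [ClassComparable, eq_comm (a := b)]

@[simp] theorem classComparable_none_some_some_none (a : K) (y : L) :
    ClassComparable ((none, some y) : Option K × Option L) (some a, none) ↔ False := by
  simp [ClassComparable]

@[simp] theorem classComparable_none_some_some_some (a : K) (y b : L) :
    ClassComparable ((none, some y) : Option K × Option L) (some a, some b) ↔ y = b := by
  simp [ClassComparable, eq_comm (a := b)]

@[simp] theorem classComparable_some_none_none_some (x : K) (b : L) :
    ClassComparable ((some x, none) : Option K × Option L) (none, some b) ↔ False := by
  simp [ClassComparable]

@[simp] theorem classComparable_some_none_some_none (x a : K) :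
    ClassComparable ((some x, none) : Option K × Option L) (some a, none) ↔ x = a := by
  simp [ClassComparable, eq_comm (a := a)]

@[simp] theorem classComparable_some_none_some_some (x a : K) (b : L) :
    ClassComparable ((some x, none) : Option K × Option L) (some a, some b) ↔ x = a := by
  simp [ClassComparable, eq_comm (a := a)]

@[simp] theorem classComparable_some_some_none_some (x : K) (y b : L) :
    ClassComparable ((some x, some y) : Option K × Option L) (none, some b) ↔ y = b := by
  simp [ClassComparable, eq_comm (a := b)]

@[simp] theorem classComparable_some_some_some_none (x a : K) (y : L) :
    ClassComparable ((some x, some y) : Option K × Option L) (some a, none) ↔ x = a := by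
  simp [ClassComparable, eq_comm (a := a)]

@[simp] theorem classComparable_some_some_some_some (x a : K) (y b : L) :
    ClassComparable ((some x, some y) : Option K × Option L) (some a, some b) ↔ x = a ∧ y = b := by
  simp [ClassComparable, eq_comm (a := a), eq_comm (a := b)]

end ClassComparable

/-! ### Sums over the product group, evaluated class by class -/

section Product

variable {A B K L : Type*} [Group A] [Group B] {p q : ℕ} {π : A → Option K} {ρ : B → Option L}

theorem IsCyclicClassMap.exists_pos_pow_iff_classComparable (hπ : IsCyclicClassMap p π)
    (hρ : IsCyclicClassMap q ρ) (hp : 0 < p) (hq : 0 < q) (hpq : p.Coprime q)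
    (hA : ∀ a : A, a ^ p = 1) (hB : ∀ b : B, b ^ q = 1) (u v : A × B) :
    ((∃ k : ℕ, 0 < k ∧ v ^ k = u) ∨ (∃ k : ℕ, 0 < k ∧ u ^ k = v)) ↔
      ClassComparable (Prod.map π ρ u) (Prod.map π ρ v) := by
  simp only [exists_pos_pow_prod_iff hp hq hpq hA hB, hπ.exists_pow_iff, hρ.exists_pow_iff,
    ClassComparable, Prod.map_fst, Prod.map_snd]

theorem IsCyclicClassMap.isSome_eq_false_iff (hπ : IsCyclicClassMap p π) (a : A) :
    (π a).isSome = false ↔ a = 1 := by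
  rw [← hπ.eq_none_iff, Option.isSome_eq_false_iff, Option.isNone_iff_eq_none]

theorem IsCyclicClassMap.isSome_iff (hπ : IsCyclicClassMap p π) (a : A) :
    (π a).isSome = true ↔ a ≠ 1 := by
  rw [ne_eq, ← hπ.isSome_eq_false_iff, Bool.not_eq_false]

theorem IsCyclicClassMap.mem_fourCells_iff (hπ : IsCyclicClassMap p π)
    (hρ : IsCyclicClassMap q ρ) (v : A × B) (i : Fin 4) :
    v ∈ fourCells A B i ↔ ((π v.1).isSome, (ρ v.2).isSome) = cellEquiv i := by
  fin_cases i <;>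
    simp [fourCells, cellEquiv, hπ.isSome_eq_false_iff, hρ.isSome_eq_false_iff, hπ.isSome_iff,
      hρ.isSome_iff]

variable [Fintype A] [Fintype B] [Fintype K] [Fintype L]

theorem IsCyclicClassMap.sum_comp_prod (hπ : IsCyclicClassMap p π)
    (hρ : IsCyclicClassMap q ρ) (hp : 1 ≤ p) (hq : 1 ≤ q) (G : Option K × Option L → ℝ) :
    ∑ v, G (Prod.map π ρ v) = G (none, none) + ((q : ℝ) - 1) * ∑ l, G (none, some l) +
      ((p : ℝ) - 1) * ∑ k, (G (some k, none) + ((q : ℝ) - 1) * ∑ l, G (some k, some l)) := by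
  simp only [Fintype.sum_prod_type, Prod.map]
  simp only [fun a => hρ.sum_comp hq fun y => G (π a, y)]
  exact hπ.sum_comp hp fun x => G (x, none) + ((q : ℝ) - 1) * ∑ l, G (x, some l)

variable [DecidableEq K] [DecidableEq L]

/-- The summand is the distance without its `-[u = v]` term, which is why the diagonal entries
exceed those of the quotient matrix by one. -/
theorem IsCyclicClassMap.sum_cell (hπ : IsCyclicClassMap p π)
    (hρ : IsCyclicClassMap q ρ) (hp : 1 ≤ p) (hq : 1 ≤ q) {n m : ℕ}
    (hK : (p : ℝ) ^ n = 1 + ((p : ℝ) - 1) * Fintype.card K)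
    (hL : (q : ℝ) ^ m = 1 + ((q : ℝ) - 1) * Fintype.card L) (u : Option K × Option L) (i j : Fin 4)
    (hu : (u.1.isSome, u.2.isSome) = cellEquiv i) :
    (∑ v : A × B, if ((π v.1).isSome, (ρ v.2).isSome) = cellEquiv j then
      (2 - if ClassComparable u (Prod.map π ρ v) then (1 : ℝ) else 0) else 0) =
      quotientMatrixD p n q m i j + if i = j then 1 else 0 := by
  refine (hπ.sum_comp_prod hρ hp hq fun y => if (y.1.isSome, y.2.isSome) = cellEquiv j then
      (2 - if ClassComparable u y then (1 : ℝ) else 0) else 0).trans ?_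
  obtain ⟨x, y⟩ := u
  rcases x with _ | x <;> rcases y with _ | y <;> fin_cases i <;>
    simp [cellEquiv] at hu <;> fin_cases j <;>
    simp [cellEquiv, quotientMatrixD, hK, hL, Finset.sum_sub_distrib, mul_sub, ite_and] <;>
    ring

theorem IsCyclicClassMap.sum_map_eq (hπ : IsCyclicClassMap p π)
    (hρ : IsCyclicClassMap q ρ) (hp : 1 ≤ p) (hq : 1 ≤ q) (y : Option K × Option L) (c : ℝ) :
    ∑ v with Prod.map π ρ v = y, c = c * (classSize p y.1 * classSize q y.2) := by
  rw [Finset.sum_filter]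
  refine (hπ.sum_comp_prod hρ hp hq fun z => if z = y then c else 0).trans ?_
  obtain ⟨x, y⟩ := y
  rcases x with _ | x <;> rcases y with _ | y <;> simp [Prod.ext_iff, ite_and] <;> ring

end Product

/-! ### Equitability and the main theorem -/

open Classical in
/-- Constancy of the distance row sums implies equitability for a graph of diameter two. -/
theorem isEquitablePartition_of_rowSum {V ι : Type*} [Fintype V] {Γ : SimpleGraph V}
    {c : ι → Set V} {T : Matrix ι ι ℝ} (hne : ∀ i, (c i).Nonempty)
    (huniq : ∀ v, ∃! i, v ∈ c i)
    (hdist : ∀ u v, distMatrix Γ u v =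
      2 - (if u = v ∨ Γ.Adj u v then 1 else 0) - (if u = v then 1 else 0))
    (hsum : ∀ i j, ∀ u ∈ c i, ∑ v with v ∈ c j, distMatrix Γ u v = T i j) :
    IsEquitablePartition Γ c := by
  refine ⟨hne, huniq, fun i j => ?_⟩
  -- The quantity `2 - d(u, v)` is 1 at a neighbour, 2 at `v = u` and 0 elsewhere; summing it over
  -- the cell counts neighbours, up to the contribution 2 of `u` itself.
  have key : ∀ u ∈ c i, ((Γ.neighborSet u ∩ c j).ncard : ℝ) =
      2 * (c j).ncard - T i j - if i = j then 2 else 0 := by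
    intro u hu
    have hij : (u ∈ c j) ↔ i = j :=
      ⟨fun h => (huniq u).unique hu h, fun h => h ▸ hu⟩
    have h₁ : ((Γ.neighborSet u ∩ c j).ncard : ℝ) =
        ∑ v with v ∈ c j, if Γ.Adj u v then (1 : ℝ) else 0 := by
      rw [Set.ncard_eq_toFinset_card', Finset.sum_boole, Finset.filter_filter]
      congr 2
      ext v
      simp [and_comm]
    have h₂ : ((c j).ncard : ℝ) = ∑ v with v ∈ c j, (1 : ℝ) := by
      rw [Set.ncard_eq_toFinset_card', Finset.sum_const, nsmul_eq_mul, mul_one]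
      congr 2
      ext v
      simp
    have h₃ : (if i = j then (2 : ℝ) else 0) = ∑ v with v ∈ c j, if u = v then 2 else 0 := by
      simp [hij]
    rw [h₁, h₂, h₃, ← hsum i j u hu, Finset.mul_sum, ← Finset.sum_sub_distrib,
      ← Finset.sum_sub_distrib]
    refine Finset.sum_congr rfl fun v _ => ?_
    rw [hdist]
    by_cases huv : u = v
    · subst huv
      simp
      norm_num
    · by_cases h : Γ.Adj u v <;> simp [huv, h]
  intro u hu v hv
  exact_mod_cast (key u hu).trans (key v hv).symm

theorem mainTheorem10 {A B : Type*} [CommGroup A] [CommGroup B] [Fintype A] [Fintype B]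
    [DecidableEq A] [DecidableEq B] (p q n m : ℕ) (hp : p.Prime) (hq : q.Prime) (hpq : p ≠ q)
    (hn : 1 ≤ n) (hm : 1 ≤ m) (hA : IsElementaryAbelian A p n) (hB : IsElementaryAbelian B q m) :
    IsDistQuotientMatrix (powerGraph (A × B)) (fourCells A B) (quotientMatrixD p n q m) ∧
    (distMatrix (powerGraph (A × B))).charpoly =
      (quotientMatrixD p n q m).charpoly *
        (X + 1) ^ (p ^ n * q ^ m - (numSubgroups p n + 1) * (numSubgroups q m + 1)) *
        (X + C (((p : ℝ) - 1) * ((q : ℝ) - 1) + 1)) ^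
          ((numSubgroups p n - 1) * (numSubgroups q m - 1)) *
        (matrixB p q m).charpoly ^ (numSubgroups p n - 1) *
        (matrixC p n q).charpoly ^ (numSubgroups q m - 1) := by
  classical
  obtain ⟨π, hπ⟩ := hA.exists_isCyclicClassMap
  obtain ⟨ρ, hρ⟩ := hB.exists_isCyclicClassMap
  have hcA : Fintype.card A = p ^ n := by rw [← Nat.card_eq_fintype_card, hA.card_eq]
  have hcB : Fintype.card B = q ^ m := by rw [← Nat.card_eq_fintype_card, hB.card_eq]
  obtain ⟨hK, hcK, hK1⟩ := hπ.card_eq_numSubgroups hp.two_le hn hcA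
  obtain ⟨hL, hcL, hL1⟩ := hρ.card_eq_numSubgroups hq.two_le hm hcB
  have hD : ∀ u v : A × B, distMatrix (powerGraph (A × B)) u v =
      2 - (if ClassComparable (Prod.map π ρ u) (Prod.map π ρ v) then 1 else 0) -
        if u = v then 1 else 0 := fun u v =>
    distMatrix_powerGraph_eq u v _ (hπ.exists_pos_pow_iff_classComparable hρ hp.pos hq.pos
      ((Nat.coprime_primes hp hq).2 hpq) hA.pow_eq_one hB.pow_eq_one u v)
  have hmem := hπ.mem_fourCells_iff hρ
  constructor
  · have hsum : ∀ i j, ∀ u ∈ fourCells A B i,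
        ∑ v with v ∈ fourCells A B j, distMatrix (powerGraph (A × B)) u v =
          quotientMatrixD p n q m i j := by
      intro i j u hu
      have hij : u ∈ fourCells A B j ↔ i = j := by
        rw [hmem, (hmem u i).1 hu, cellEquiv.apply_eq_iff_eq]
      have h := hπ.sum_cell (B := B) hρ hp.one_le hq.one_le hK hL (Prod.map π ρ u) i j
        ((hmem u i).1 hu)
      simp only [hD, Finset.sum_sub_distrib, Finset.sum_ite_eq, Finset.mem_filter,
        Finset.mem_univ, true_and, hij]
      rw [← Finset.sum_sub_distrib, Finset.sum_filter]
      simp only [hmem]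
      rw [h]
      ring
    refine ⟨isEquitablePartition_of_rowSum (fun i => ?_) (fun v => ?_) (fun u v => ?_) hsum,
      fun i j u hu => ?_⟩
    · obtain ⟨a, ha⟩ : ∃ a : A, a ≠ 1 := by
        have : Nontrivial A := Fintype.one_lt_card_iff_nontrivial.1
          (hcA ▸ Nat.one_lt_pow (by omega) hp.one_lt)
        exact exists_ne 1
      obtain ⟨b, hb⟩ : ∃ b : B, b ≠ 1 := by
        have : Nontrivial B := Fintype.one_lt_card_iff_nontrivial.1
          (hcB ▸ Nat.one_lt_pow (by omega) hq.one_lt)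
        exact exists_ne 1
      fin_cases i
      exacts [⟨(1, 1), by simp [fourCells]⟩, ⟨(a, 1), by simp [fourCells, ha]⟩,
        ⟨(a, b), by simp [fourCells, ha, hb]⟩, ⟨(1, b), by simp [fourCells, hb]⟩]
    · refine ⟨cellEquiv.symm ((π v.1).isSome, (ρ v.2).isSome), ?_, fun i hi => ?_⟩
      · simp [hmem]
      · rw [(hmem v i).1 hi, Equiv.symm_apply_apply]
    · rw [distMatrix_powerGraph_eq u v _ Iff.rfl]
      congr 3
      refine propext ?_
      by_cases huv : u = v
      · simp only [huv, true_or, iff_true]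
        exact Or.inl ⟨1, one_pos, pow_one v⟩
      · simp [powerGraph, huv]
    · convert hsum i j u hu
  · have hDm : distMatrix (powerGraph (A × B)) =
        (Matrix.of fun x y => 2 - if ClassComparable x y then (1 : ℝ) else 0).submatrix
          (Prod.map π ρ) (Prod.map π ρ) - 1 := by
      ext u v
      simp [hD, Matrix.one_apply]
    have hcomap := Matrix.charpoly_comap_sub_one (Prod.map π ρ)
      (Matrix.of fun x y => 2 - if ClassComparable x y then (1 : ℝ) else 0)
    have hcl : (Matrix.of fun i j => ∑ v with Prod.map π ρ v = j,
        (Matrix.of fun x y => 2 - if ClassComparable x y then (1 : ℝ) else 0) i j) - 1 =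
          classMatrix _ _ p q := by
      ext u v
      simp only [classMatrix, Matrix.sub_apply, Matrix.of_apply, Matrix.one_apply,
        hπ.sum_map_eq hρ hp.one_le hq.one_le]
    -- There are at most as many classes as elements, so the truncated subtraction in the exponent
    -- of `X + 1` is exact and that power can be cancelled.
    have hle : (numSubgroups p n + 1) * (numSubgroups q m + 1) ≤ p ^ n * q ^ m :=
      Nat.mul_le_mul (numSubgroups_add_one_le hp.two_le n) (numSubgroups_add_one_le hq.two_le m)
    have hne : ((X : ℝ[X]) + 1) ≠ 0 := by simpa using (monic_X_add_C (1 : ℝ)).ne_zero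
    rw [← hDm, hcl, Fintype.card_prod, Fintype.card_prod, Fintype.card_option,
      Fintype.card_option, hcA, hcB, charpoly_classMatrix hK hL, hcK, hcL,
      ← Nat.sub_add_cancel hle, pow_add] at hcomap
    refine mul_right_cancel₀ (pow_ne_zero _ hne) (hcomap.trans ?_)
    ring
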